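/- Let $X$, $U$ be arbitrary sets and $W$ a countable set, let $U(x)\subset U$ be a constraint set for each $x\in X$, let $f:X\times U\times W\to X$ be the system function, $g:X\times U\times W\to[0,\infty)$ the cost per stage, $P(\cdot\mid x,u)$ a probability distribution on $W$ for each $(x,u)$, and $t\in X$ a destination such that $f(t,u,w)=t$ and $g(t,u,w)=0$ for all $u\in U(t)$, $w\in W$. A policy is a sequence $\pi=\{\mu_0,\mu_1,\ldots\}$ of functions $\mu_k:X\to U$ with $\mu_k(x)\in U(x)$ for all $x\in X$. Starting from $x_0$, it generates states $x_{k+1}=f(x_k,\mu_k(x_k),w_k)$, where $w_k$ has distribution $P(\cdot\mid x_k,\mu_k(x_k))$ given $x_k$ and the past. Put $$J_\pi(x_0)=\sum_{k=0}^\infty E^\pi_{x_0}\{g(x_k,\mu_k(x_k),w_k)\}\in[0,\infty],\qquad J^*(x)=\inf_\pi J_\pi(x),$$ and let $r_k(\pi,x)$ be the probability that $x_k\ne t$ when $\pi$ is used and $x_0=x$. A policy $\pi$ is proper at $x$ if $J_\pi(x)<\infty$ and $\sum_{k=0}^\infty r_k(\pi,x)<\infty$. Let $\hat J(x)$ be the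 infimum of $J_\pi(x)$ over the policies $\pi$ that are proper at $x$ (with $\inf\emptyset=\infty$), and let $\widehat X=\{x\mid\hat J(x)<\infty\}$ and $X^*=\{x\mid J^*(x)<\infty\}$. A policy $\pi$ is uniformly proper if $\sup_{x\in\widehat X}\sum_{k=0}^\infty r_k(\pi,x)<\infty$. Let $\mathcal B$ be the set of functions $J:X\to[0,\infty]$ with $J(t)=0$ and $\sup_{x\in\widehat X}J(x)<\infty$. Bellman's equation for a function $J:X\to[0,\infty]$ is $$J(x)=\inf_{u\in U(x)}E\{g(x,u,w)+J(f(x,u,w))\},\qquad x\in X,$$ where the expected value is with respect to $P(w\mid x,u)$. Assume that $g$ is bounded over $X\times U\times W$ and that there exists a uniformly proper policy. Then: (a) $\hat J$ is the largest solution of Bellman's equation within $\mathcal B$, i.e., $\hat J$ is a solution that belongs to $\mathcal B$, and if $\tilde J\in\mathcal B$ is another solution, then $\tilde J\le\hat J$. Moreover, if $\hat J=J^*$, then $J^*$ is the unique solution of Bellman's equation within $\mathcal B$. (b) If $J_0\in\mathcal B$, $J_0\ge\hat J$, and $\{J_k\}$ is the sequence generated by value iteration, $J_{k+1}(x)=\inf_{u\in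 U(x)}E\{g(x,u,w)+J_k(f(x,u,w))\}$ for $x\in X$, $k=0,1,\ldots$, then $J_k\to\hat J$ pointwise on $X$. (c) If in addition $X$ is finite, $J^*(x)>0$ for all $x\ne t$, and $X^*=\widehat X$, then $\hat J=J^*$. -/

import Mathlib

open scoped ENNReal NNReal Topology

noncomputable section

/-- Expectation of a `[0,∞]`-valued function under a discrete probability distribution. -/
def PMF.expect {α : Type*} (p : PMF α) (h : α → ℝ≥0∞) : ℝ≥0∞ :=
  ∑' a, p a * h a

/-- The data of a stochastic shortest path problem with state space `X`, control space `U`,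
disturbance space `W`, nonnegative real cost per stage, and a cost-free absorbing destination. -/
structure SSP (X U W : Type*) where
  /-- the control constraint set at each state -/
  admissible : X → Set U
  /-- the system function: the next state is `f x u w` -/
  f : X → U → W → X
  /-- the cost per stage -/
  g : X → U → W → ℝ≥0
  /-- the conditional distribution of the disturbance, given the state and the control -/
  P : X → U → PMF W
  /-- the destination -/
  t : X
  f_absorbing : ∀ u ∈ admissible t, ∀ w, f t u w = t
  g_costFree : ∀ u ∈ admissible t, ∀ w, g t u w = 0

namespace SSP

variable {X U W : Type*} (S : SSP X U W)

/-- Policies `{μ₀, μ₁, …}`: sequences of functions `μ k : X → U` with `μ k x` an admissible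
control at `x`. -/
def Policy : Type _ :=
  {μ : ℕ → X → U // ∀ k x, μ k x ∈ S.admissible x}

/-- The law of the state `x_k` of the system `x_{k+1} = f (x_k, μ_k(x_k), w_k)` when
`x_0 = x` and `w_k` has the distribution `P(· | x_k, μ_k(x_k))` given `x_k` and the past. -/
def stateLaw (π : S.Policy) (x : X) : ℕ → PMF X
  | 0 => PMF.pure x
  | k + 1 => (stateLaw π x k).bind fun y =>
      (S.P y (π.1 k y)).map fun w => S.f y (π.1 k y) w

/-- The expected cost of stage `k`, that is, the expected value of `g (x_k, μ_k(x_k), w_k)`. -/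
def stageCost (π : S.Policy) (x : X) (k : ℕ) : ℝ≥0∞ :=
  (S.stateLaw π x k).expect fun y =>
    (S.P y (π.1 k y)).expect fun w => (S.g y (π.1 k y) w : ℝ≥0∞)

/-- The cost function of a policy. -/
def cost (π : S.Policy) (x : X) : ℝ≥0∞ :=
  ∑' k, S.stageCost π x k

/-- The optimal cost function, the infimum of the costs of all policies. -/
def optCost (x : X) : ℝ≥0∞ :=
  ⨅ π : S.Policy, S.cost π x

/-- The probability that `x_k` differs from the destination, starting at `x` under `π`. -/
def notReached (π : S.Policy) (x : X) (k : ℕ) : ℝ≥0∞ :=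
  (S.stateLaw π x k).toOuterMeasure {S.t}ᶜ

/-- The expected number of steps to reach the destination, starting at `x` under `π`. -/
def expectedSteps (π : S.Policy) (x : X) : ℝ≥0∞ :=
  ∑' k, S.notReached π x k

/-- The policy `π` is proper at the state `x`. -/
def ProperAt (π : S.Policy) (x : X) : Prop :=
  S.cost π x < ⊤ ∧ S.expectedSteps π x < ⊤

/-- The restricted optimal cost function: at each state `x`, the infimum of the costs of the
policies that are proper at `x` (it is `⊤` if there is none). -/
def properOptCost (x : X) : ℝ≥0∞ :=
  ⨅ (π : S.Policy) (_ : S.ProperAt π x), S.cost π x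

/-- The effective domain of a `[0,∞]`-valued function. -/
def effDom (J : X → ℝ≥0∞) : Set X :=
  {x | J x < ⊤}

/-- Uniformly proper policies: the expected number of steps to the destination is bounded over
the effective domain of the restricted optimal cost function. -/
def UniformlyProper (π : S.Policy) : Prop :=
  (⨆ x ∈ effDom S.properOptCost, S.expectedSteps π x) < ⊤

/-- The functions `J : X → [0,∞]` that vanish at the destination and are bounded over the
effective domain of the restricted optimal cost function. -/
def boundedClass : Set (X → ℝ≥0∞) :=
  {J | J S.t = 0 ∧ (⨆ x ∈ effDom S.properOptCost, J x) < ⊤}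

/-- The Bellman operator, the right-hand side of Bellman's equation. -/
def bellman (J : X → ℝ≥0∞) (x : X) : ℝ≥0∞ :=
  ⨅ u ∈ S.admissible x, (S.P x u).expect fun w => (S.g x u w : ℝ≥0∞) + J (S.f x u w)

/-- `J` solves Bellman's equation at every state. -/
def IsBellmanSolution (J : X → ℝ≥0∞) : Prop :=
  ∀ x, J x = S.bellman J x

end SSP

end

/-! Charge an extra `δ > 0` per stage away from the destination. The cost of a policy becomes its
cost plus `δ` times its expected number of steps, which is finite exactly when the policy is proper.
Hence the optimal costs of the perturbed problems decrease to `properOptCost` as `δ → 0`. Each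
solves its own Bellman equation by the theory of nonnegative costs, and the equation passes to the
limit. One inequality is monotonicity; the other exchanges a decreasing limit with an expectation,
where bounded `g` and the uniformly proper policy supply the finite dominating bound.

Under a policy proper at `x`, the expected terminal cost `E J(x_k)` is at most `sup J` times the
probability of not having terminated, so it vanishes. This gives maximality and convergence of value
iteration. Uniqueness holds when `properOptCost = optCost` because `optCost` is the smallest
solution. In (c), a positive minimum of `optCost` off the destination forces termination with
probability one under any policy of finite cost, which suffices for the same comparison. -/

noncomputable section

open Filter

/-! ### Calculus of discrete expectations -/

namespace PMF

variable {α β : Type*}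

theorem expect_mono_support (p : PMF α) {h₁ h₂ : α → ℝ≥0∞}
    (h : ∀ a ∈ p.support, h₁ a ≤ h₂ a) : p.expect h₁ ≤ p.expect h₂ := by
  refine ENNReal.tsum_le_tsum fun a => ?_
  by_cases ha : p a = 0
  · simp [ha]
  · exact mul_le_mul_right (h a ((p.mem_support_iff a).2 ha)) _

theorem expect_mono (p : PMF α) {h₁ h₂ : α → ℝ≥0∞} (h : ∀ a, h₁ a ≤ h₂ a) :
    p.expect h₁ ≤ p.expect h₂ :=
  p.expect_mono_support fun a _ => h a

theorem expect_add (p : PMF α) (h₁ h₂ : α → ℝ≥0∞) :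
    (p.expect fun a => h₁ a + h₂ a) = p.expect h₁ + p.expect h₂ := by
  simp only [expect, mul_add, ENNReal.tsum_add]

theorem expect_const (p : PMF α) (c : ℝ≥0∞) : (p.expect fun _ => c) = c := by
  simp only [expect, ENNReal.tsum_mul_right, p.tsum_coe, one_mul]

theorem expect_const_mul (p : PMF α) (c : ℝ≥0∞) (h : α → ℝ≥0∞) :
    (p.expect fun a => c * h a) = c * p.expect h := by
  simp only [expect, ← ENNReal.tsum_mul_left, mul_left_comm]

theorem expect_tsum {ι : Type*} (p : PMF α) (h : ι → α → ℝ≥0∞) :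
    (p.expect fun a => ∑' i, h i a) = ∑' i, p.expect (h i) := by
  simp only [expect, ← ENNReal.tsum_mul_left]
  exact ENNReal.tsum_comm

theorem expect_pure (a : α) (h : α → ℝ≥0∞) : (PMF.pure a).expect h = h a := by
  rw [expect, tsum_eq_single a]
  · simp
  · intro b hb
    simp [hb]

theorem expect_bind (p : PMF α) (q : α → PMF β) (h : β → ℝ≥0∞) :
    (p.bind q).expect h = p.expect fun a => (q a).expect h := by
  simp only [expect, bind_apply, ← ENNReal.tsum_mul_right, ← ENNReal.tsum_mul_left, mul_assoc]
  exact ENNReal.tsum_comm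

theorem expect_map (p : PMF α) (f : α → β) (h : β → ℝ≥0∞) :
    (p.map f).expect h = p.expect fun a => h (f a) := by
  rw [← bind_pure_comp, expect_bind]
  simp only [Function.comp, expect_pure]

theorem lt_top_of_expect_lt_top {p : PMF α} {h : α → ℝ≥0∞} (hp : p.expect h < ⊤) {a : α}
    (ha : a ∈ p.support) : h a < ⊤ := by
  by_contra hn
  rw [not_lt, top_le_iff] at hn
  have h1 : p a * h a ≤ p.expect h := ENNReal.le_tsum a
  rw [hn, ENNReal.mul_top ((p.mem_support_iff a).1 ha)] at h1
  exact absurd h1 (not_le.2 hp)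

theorem expect_iInf_of_antitone (p : PMF α) {h : ℕ → α → ℝ≥0∞} (hanti : Antitone h)
    (h0 : p.expect (h 0) ≠ ⊤) :
    (p.expect fun a => ⨅ n, h n a) = ⨅ n, p.expect (h n) := by
  let _ : MeasurableSpace α := ⊤
  have hmul : ∀ a, p a * ⨅ n, h n a = ⨅ n, p a * h n a := fun a =>
    ENNReal.mul_iInf fun h => absurd h (p.apply_ne_top a)
  simp only [expect, hmul] at h0 ⊢
  simp only [← MeasureTheory.lintegral_count] at h0 ⊢
  exact MeasureTheory.lintegral_iInf (fun n => measurable_from_top)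
    (fun m n hmn a => mul_le_mul_right (hanti hmn a) _) h0

end PMF

/-! ### Dynamic programming with nonnegative costs -/

namespace SSP

variable {X U W : Type*} (S : SSP X U W)

theorem bellman_mono : Monotone S.bellman := fun _ _ h _ =>
  iInf₂_mono fun _ _ => PMF.expect_mono _ fun _ => add_le_add_right (h _) _

theorem bellman_le {J : X → ℝ≥0∞} {x : X} {u : U} (hu : u ∈ S.admissible x) :
    S.bellman J x ≤ (S.P x u).expect fun w => (S.g x u w : ℝ≥0∞) + J (S.f x u w) :=
  iInf₂_le u hu

/-- The policy that uses at stage `k` the control function of stage `m + k` of `π`. -/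
def shift (m : ℕ) (π : S.Policy) : S.Policy :=
  ⟨fun k => π.1 (m + k), fun k => π.2 (m + k)⟩

variable {S} (π : S.Policy) (x : X)

theorem stateLaw_add (m k : ℕ) :
    S.stateLaw π x (m + k) = (S.stateLaw π x m).bind fun y => S.stateLaw (S.shift m π) y k := by
  induction k with
  | zero => simp [stateLaw]
  | succ k ih =>
    rw [← add_assoc, stateLaw, ih, PMF.bind_bind]
    rfl

theorem expect_stateLaw_succ (k : ℕ) (J : X → ℝ≥0∞) :
    (S.stateLaw π x (k + 1)).expect J = (S.stateLaw π x k).expect fun y =>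
      (S.P y (π.1 k y)).expect fun w => J (S.f y (π.1 k y) w) := by
  simp only [stateLaw, PMF.expect_bind, PMF.expect_map]

theorem stageCost_add_expect_stateLaw_succ (k : ℕ) (J : X → ℝ≥0∞) :
    S.stageCost π x k + (S.stateLaw π x (k + 1)).expect J = (S.stateLaw π x k).expect fun y =>
      (S.P y (π.1 k y)).expect fun w =>
        (S.g y (π.1 k y) w : ℝ≥0∞) + J (S.f y (π.1 k y) w) := by
  rw [expect_stateLaw_succ, stageCost]
  simp only [PMF.expect_add]

theorem expect_bellman_le (k : ℕ) (J : X → ℝ≥0∞) :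
    (S.stateLaw π x k).expect (S.bellman J) ≤
      S.stageCost π x k + (S.stateLaw π x (k + 1)).expect J := by
  rw [stageCost_add_expect_stateLaw_succ]
  exact PMF.expect_mono _ fun y => S.bellman_le (π.2 k y)

theorem stageCost_add (m k : ℕ) :
    S.stageCost π x (m + k) =
      (S.stateLaw π x m).expect fun y => S.stageCost (S.shift m π) y k := by
  simp only [stageCost, stateLaw_add, PMF.expect_bind]
  rfl

theorem tsum_stageCost_add (m : ℕ) :
    ∑' k, S.stageCost π x (k + m) =
      (S.stateLaw π x m).expect (S.cost (S.shift m π)) := by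
  simp only [add_comm _ m, stageCost_add]
  exact (PMF.expect_tsum _ fun k y => S.stageCost (S.shift m π) y k).symm

theorem cost_eq_sum_add (m : ℕ) :
    S.cost π x = ∑ k ∈ Finset.range m, S.stageCost π x k +
      (S.stateLaw π x m).expect (S.cost (S.shift m π)) := by
  rw [← tsum_stageCost_add, cost]
  exact (Summable.sum_add_tsum_nat_add' ENNReal.summable).symm

theorem bellman_optCost_le : S.bellman S.optCost ≤ S.optCost := by
  intro x
  refine le_iInf fun π => ?_
  have h0 := expect_bellman_le π x 0 S.optCost
  rw [show S.stateLaw π x 0 = PMF.pure x from rfl, PMF.expect_pure] at h0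
  rw [cost_eq_sum_add π x 1, Finset.sum_range_one]
  refine h0.trans (add_le_add_right (PMF.expect_mono _ fun y => iInf_le _ _) _)

/-- Iterates that decrease at least as fast as value iteration are bounded by the costs of finite
horizon problems with terminal cost. -/
theorem le_sum_stageCost_add_expect {J : ℕ → X → ℝ≥0∞}
    (hJ : ∀ k, J (k + 1) ≤ S.bellman (J k)) (n k : ℕ) :
    J (n + k) x ≤ ∑ j ∈ Finset.range k, S.stageCost π x j +
      (S.stateLaw π x k).expect (J n) := by
  induction k generalizing n with
  | zero => simp [stateLaw, PMF.expect_pure]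
  | succ k ih =>
    have h1 := ih (n + 1)
    rw [show n + (k + 1) = n + 1 + k by ring, Finset.sum_range_succ,
      add_assoc (Finset.sum _ _)]
    exact h1.trans (add_le_add_right
      ((PMF.expect_mono _ (hJ n)).trans (expect_bellman_le π x k (J n))) _)

/-- At stage `k`, choose a control attaining the Bellman infimum up to `e k`, with the errors
summing to less than `ε`; the accumulated cost then telescopes against `J`. -/
theorem exists_policy_cost_le [Nonempty S.Policy] {J : X → ℝ≥0∞} (hJ : S.bellman J ≤ J)
    {ε : ℝ≥0∞} (hε : ε ≠ 0) : ∃ π : S.Policy, ∀ x, S.cost π x ≤ J x + ε := by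
  obtain ⟨e, he, hes⟩ := ENNReal.exists_pos_sum_of_countable' hε ℕ
  obtain ⟨π₀⟩ := ‹Nonempty S.Policy›
  have hsel : ∀ k x, ∃ u ∈ S.admissible x,
      ((S.P x u).expect fun w => (S.g x u w : ℝ≥0∞) + J (S.f x u w)) ≤ J x + e k := by
    intro k x
    by_cases hx : J x = ⊤
    -- Where `J` is infinite any admissible control will do.
    · exact ⟨π₀.1 0 x, π₀.2 0 x, by simp [hx]⟩
    · have hlt : S.bellman J x < J x + e k :=
        (hJ x).trans_lt (ENNReal.lt_add_right hx (he k).ne')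
      simp only [bellman, iInf_lt_iff] at hlt
      obtain ⟨u, hu, hlt⟩ := hlt
      exact ⟨u, hu, hlt.le⟩
  choose μ hμ hle using hsel
  let π : S.Policy := ⟨μ, hμ⟩
  refine ⟨π, fun x => ?_⟩
  have key : ∀ k, ∑ j ∈ Finset.range k, S.stageCost π x j + (S.stateLaw π x k).expect J ≤
      J x + ∑ j ∈ Finset.range k, e j := by
    intro k
    induction k with
    | zero => simp [stateLaw, PMF.expect_pure]
    | succ k ih =>
      have h1 : S.stageCost π x k + (S.stateLaw π x (k + 1)).expect J ≤
          (S.stateLaw π x k).expect J + e k := by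
        rw [stageCost_add_expect_stateLaw_succ, ← (S.stateLaw π x k).expect_const (e k),
          ← PMF.expect_add]
        exact PMF.expect_mono _ fun y => hle k y
      rw [Finset.sum_range_succ, Finset.sum_range_succ, add_assoc]
      refine (add_le_add_right h1 _).trans ?_
      rw [← add_assoc, ← add_assoc]
      exact add_le_add_left ih _
  rw [cost, ENNReal.tsum_eq_iSup_nat]
  refine iSup_le fun k => (le_self_add.trans (key k)).trans (add_le_add_right ?_ _)
  exact (ENNReal.sum_le_tsum _).trans hes.le

/-- The optimal cost function is below every function that the Bellman operator decreases. -/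
theorem optCost_le_of_bellman_le [Nonempty S.Policy] {J : X → ℝ≥0∞} (hJ : S.bellman J ≤ J) :
    S.optCost ≤ J := by
  intro x
  refine ENNReal.le_of_forall_pos_le_add fun ε hε _ => ?_
  obtain ⟨π, hπ⟩ := exists_policy_cost_le hJ (ε := ε) (by simpa using hε.ne')
  exact (iInf_le _ π).trans (hπ x)

/-- By monotonicity the Bellman operator also decreases `S.bellman S.optCost`, so minimality gives
the missing inequality. -/
theorem isBellmanSolution_optCost [Nonempty S.Policy] : S.IsBellmanSolution S.optCost := fun x =>
  le_antisymm (optCost_le_of_bellman_le (S.bellman_mono bellman_optCost_le) x)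
    (bellman_optCost_le x)

/-! ### Perturbation by a charge on time -/

variable (S) in
open Classical in
/-- The problem whose cost per stage is increased by `δ` at all states but the destination. -/
@[reducible]
def perturb (δ : ℝ≥0) : SSP X U W where
  admissible := S.admissible
  f := S.f
  g x u w := S.g x u w + if x = S.t then 0 else δ
  P := S.P
  t := S.t
  f_absorbing := S.f_absorbing
  g_costFree u hu w := by simp [S.g_costFree u hu w]

/-- A policy as a policy of the perturbed problem. -/
def Policy.perturb (δ : ℝ≥0) : (S.perturb δ).Policy :=
  ⟨π.1, π.2⟩

theorem stateLaw_perturb (δ : ℝ≥0) (k : ℕ) :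
    (S.perturb δ).stateLaw (π.perturb δ) x k = S.stateLaw π x k := by
  induction k with
  | zero => rfl
  | succ k ih =>
    exact congrArg (fun p : PMF X => p.bind fun y =>
      (S.P y (π.1 k y)).map fun w => S.f y (π.1 k y) w) ih

open Classical in
theorem notReached_eq_expect (k : ℕ) :
    S.notReached π x k = (S.stateLaw π x k).expect fun y => if y = S.t then 0 else 1 := by
  rw [notReached, PMF.toOuterMeasure_apply, PMF.expect]
  refine tsum_congr fun y => ?_
  by_cases h : y = S.t <;> simp [h]

theorem stageCost_perturb (δ : ℝ≥0) (k : ℕ) :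
    (S.perturb δ).stageCost (π.perturb δ) x k = S.stageCost π x k + δ * S.notReached π x k := by
  classical
  rw [notReached_eq_expect, ← PMF.expect_const_mul, stageCost, stageCost, stateLaw_perturb,
    ← PMF.expect_add]
  congr 1
  funext y
  simp only [ENNReal.coe_add, PMF.expect_add]
  rw [PMF.expect_const]
  by_cases h : y = S.t <;> simp [h, Policy.perturb]

theorem cost_perturb (δ : ℝ≥0) :
    (S.perturb δ).cost (π.perturb δ) x = S.cost π x + δ * S.expectedSteps π x := by
  simp only [cost, stageCost_perturb, expectedSteps, ENNReal.tsum_add, ENNReal.tsum_mul_left]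

theorem optCost_perturb_eq_iInf (δ : ℝ≥0) :
    (S.perturb δ).optCost x = ⨅ π : S.Policy, S.cost π x + δ * S.expectedSteps π x := by
  refine le_antisymm (le_iInf fun π => ?_) (le_iInf fun π => ?_)
  · rw [← cost_perturb]
    exact iInf_le _ _
  · exact (iInf_le _ (⟨π.1, π.2⟩ : S.Policy)).trans (cost_perturb _ _ _).ge

variable {π x}

theorem cost_add_mul_expectedSteps_lt_top_iff {δ : ℝ≥0} (hδ : 0 < δ) :
    S.cost π x + δ * S.expectedSteps π x < ⊤ ↔ S.ProperAt π x := by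
  rw [ProperAt, ENNReal.add_lt_top]
  refine and_congr_right fun _ => ⟨fun h => ?_, fun h => ENNReal.mul_lt_top (by simp) h⟩
  by_contra hn
  rw [not_lt, top_le_iff] at hn
  rw [hn, ENNReal.mul_top (by simpa using hδ.ne')] at h
  exact lt_irrefl _ h

/-- Properness is finiteness of one perturbed cost, and a finite cost has a finite expected tail. -/
theorem ProperAt.shift (h : S.ProperAt π x) {k : ℕ} {y : X}
    (hy : y ∈ (S.stateLaw π x k).support) : S.ProperAt (S.shift k π) y := by
  rw [← cost_add_mul_expectedSteps_lt_top_iff one_pos, ← cost_perturb] at h ⊢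
  rw [cost_eq_sum_add _ _ k, ENNReal.add_lt_top, stateLaw_perturb] at h
  exact PMF.lt_top_of_expect_lt_top h.2 hy

theorem ProperAt.properOptCost_le (h : S.ProperAt π x) : S.properOptCost x ≤ S.cost π x :=
  iInf₂_le π h

theorem ProperAt.mem_effDom (h : S.ProperAt π x) : x ∈ effDom S.properOptCost :=
  h.properOptCost_le.trans_lt h.1

theorem optCost_le_properOptCost : S.optCost ≤ S.properOptCost := fun _ =>
  le_iInf₂ fun π _ => iInf_le _ π

theorem properOptCost_le_optCost_perturb {δ : ℝ≥0} (hδ : 0 < δ) :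
    S.properOptCost ≤ (S.perturb δ).optCost := by
  intro x
  rw [optCost_perturb_eq_iInf]
  refine le_iInf fun π => ?_
  by_cases h : S.cost π x + δ * S.expectedSteps π x < ⊤
  · exact ((cost_add_mul_expectedSteps_lt_top_iff hδ).1 h).properOptCost_le.trans le_self_add
  · rw [not_lt, top_le_iff] at h
    exact h ▸ le_top

theorem optCost_perturb_mono : Monotone fun δ : ℝ≥0 => (S.perturb δ).optCost := by
  intro δ₁ δ₂ h x
  simp only [optCost_perturb_eq_iInf]
  gcongr

theorem properOptCost_eq_iInf {δ : ℕ → ℝ≥0} (hδ : ∀ n, 0 < δ n) (hlim : Tendsto δ atTop (𝓝 0))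
    (x : X) : S.properOptCost x = ⨅ n, (S.perturb (δ n)).optCost x := by
  refine le_antisymm (le_iInf fun n => properOptCost_le_optCost_perturb (hδ n) x)
    (le_iInf₂ fun π hπ => ?_)
  have h1 : Tendsto (fun n => S.cost π x + (δ n : ℝ≥0∞) * S.expectedSteps π x) atTop
      (𝓝 (S.cost π x + ((0 : ℝ≥0) : ℝ≥0∞) * S.expectedSteps π x)) :=
    tendsto_const_nhds.add
      (ENNReal.Tendsto.mul_const (ENNReal.tendsto_coe.2 hlim) (Or.inr hπ.2.ne))
  rw [ENNReal.coe_zero, zero_mul, add_zero] at h1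
  refine ge_of_tendsto' h1 fun n => ?_
  refine (iInf_le _ n).trans ?_
  rw [optCost_perturb_eq_iInf]
  exact iInf_le _ π

theorem stateLaw_destination (π : S.Policy) (k : ℕ) : S.stateLaw π S.t k = PMF.pure S.t := by
  induction k with
  | zero => rfl
  | succ k ih =>
    rw [stateLaw, ih, PMF.pure_bind]
    simp only [S.f_absorbing _ (π.2 k S.t)]
    exact PMF.map_const _ _

theorem cost_destination (π : S.Policy) : S.cost π S.t = 0 := by
  simp only [cost, stageCost, stateLaw_destination, PMF.expect_pure,
    S.g_costFree _ (π.2 _ S.t), ENNReal.coe_zero, PMF.expect_const, tsum_zero]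

theorem properAt_destination (π : S.Policy) : S.ProperAt π S.t := by
  refine ⟨by simp [cost_destination], ?_⟩
  classical
  simp [expectedSteps, notReached_eq_expect, stateLaw_destination, PMF.expect_pure]

theorem properOptCost_destination [Nonempty S.Policy] : S.properOptCost S.t = 0 := by
  obtain ⟨π⟩ := ‹Nonempty S.Policy›
  exact le_antisymm ((properAt_destination π).properOptCost_le.trans (cost_destination π).le)
    zero_le

/-! ### Bellman's equation for the restricted optimal cost -/

theorem stageCost_le {C : ℝ≥0} (hC : ∀ x u w, S.g x u w ≤ C) (π : S.Policy) (x : X) (k : ℕ) :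
    S.stageCost π x k ≤ C * S.notReached π x k := by
  classical
  rw [notReached_eq_expect, ← PMF.expect_const_mul, stageCost]
  refine PMF.expect_mono _ fun y => ?_
  by_cases h : y = S.t
  · subst h
    simp [S.g_costFree _ (π.2 k S.t), PMF.expect_const]
  · simp only [h, if_false, mul_one]
    refine (PMF.expect_mono _ fun w => ENNReal.coe_le_coe.2 (hC _ _ w)).trans ?_
    rw [PMF.expect_const]

theorem cost_le_mul_expectedSteps {C : ℝ≥0} (hC : ∀ x u w, S.g x u w ≤ C) (π : S.Policy) (x : X) :
    S.cost π x ≤ C * S.expectedSteps π x := by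
  rw [cost, expectedSteps, ← ENNReal.tsum_mul_left]
  exact ENNReal.tsum_le_tsum fun k => stageCost_le hC π x k

/-- With bounded cost per stage and a uniformly proper policy, the optimal costs of the perturbed
problems are bounded on the effective domain of the restricted optimal cost function. -/
theorem exists_bound_optCost_perturb (hg : ∃ C : ℝ≥0, ∀ x u w, S.g x u w ≤ C)
    (hπ : ∃ π : S.Policy, S.UniformlyProper π) (δ : ℝ≥0) :
    ∃ M : ℝ≥0∞, M < ⊤ ∧ ∀ x ∈ effDom S.properOptCost, (S.perturb δ).optCost x ≤ M := by
  obtain ⟨C, hC⟩ := hg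
  obtain ⟨π, hπ⟩ := hπ
  refine ⟨(C + δ) * _, ENNReal.mul_lt_top (by simp) hπ, fun x hx => ?_⟩
  rw [optCost_perturb_eq_iInf]
  refine (iInf_le _ π).trans ?_
  refine (add_le_add_left (cost_le_mul_expectedSteps hC π x) _).trans ?_
  rw [← add_mul]
  exact mul_le_mul_right (le_iSup₂ (f := fun x _ => S.expectedSteps π x) x hx) _

theorem bellman_properOptCost_le (hne : Nonempty S.Policy) :
    S.bellman S.properOptCost ≤ S.properOptCost := by
  intro x
  rw [properOptCost_eq_iInf (S := S) (δ := fun n => 1 / ((n : ℝ≥0) + 1))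
    (fun n => by positivity) tendsto_one_div_add_atTop_nhds_zero_nat x]
  refine le_iInf fun n => ?_
  set δ : ℝ≥0 := 1 / ((n : ℝ≥0) + 1)
  have hδ : 0 < δ := by positivity
  have : Nonempty (S.perturb δ).Policy := hne
  rw [isBellmanSolution_optCost (S := S.perturb δ) x]
  refine iInf₂_mono fun u hu => PMF.expect_mono _ fun w => add_le_add ?_
    (properOptCost_le_optCost_perturb hδ _)
  exact ENNReal.coe_le_coe.2 le_self_add

theorem properOptCost_le_bellman (hg : ∃ C : ℝ≥0, ∀ x u w, S.g x u w ≤ C)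
    (hπ : ∃ π : S.Policy, S.UniformlyProper π) :
    S.properOptCost ≤ S.bellman S.properOptCost := by
  refine fun x => le_iInf₂ fun u hu => ?_
  rw [PMF.expect_add]
  set E := (S.P x u).expect fun w => S.properOptCost (S.f x u w) with hE
  by_cases hfin : E = ⊤
  · rw [hfin, add_top]
    exact le_top
  obtain ⟨M, hM, hMle⟩ := exists_bound_optCost_perturb hg hπ 1
  obtain ⟨π, -⟩ := hπ
  set δ : ℕ → ℝ≥0 := fun n => 1 / ((n : ℝ≥0) + 1) with hδdef
  have hδ : ∀ n, 0 < δ n := fun n => by positivity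
  have hlim : Tendsto δ atTop (𝓝 0) := tendsto_one_div_add_atTop_nhds_zero_nat
  have hanti : Antitone δ := fun m n h => by
    simp only [hδdef]
    gcongr
  have hEeq : E = ⨅ n, (S.P x u).expect fun w => (S.perturb (δ n)).optCost (S.f x u w) := by
    rw [← PMF.expect_iInf_of_antitone]
    · simp only [hE, properOptCost_eq_iInf hδ hlim]
    · exact fun m n h w => optCost_perturb_mono (hanti h) _
    -- The first term has `δ 0 = 1`, hence the bound `M`; finiteness of `E` puts every possible
    -- successor in the effective domain.
    · refine ((PMF.expect_mono_support _ fun w hw => hMle _ ?_).trans_lt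
        ((PMF.expect_const _ M).trans_lt hM)).ne |> fun h => by simpa [hδdef] using h
      exact PMF.lt_top_of_expect_lt_top (lt_top_iff_ne_top.2 hfin) hw
  have hstep : ∀ n, S.properOptCost x ≤
      ((S.P x u).expect fun w => (S.g x u w : ℝ≥0∞)) + δ n +
        (S.P x u).expect fun w => (S.perturb (δ n)).optCost (S.f x u w) := by
    intro n
    have : Nonempty (S.perturb (δ n)).Policy := ⟨π⟩
    refine (properOptCost_le_optCost_perturb (hδ n) x).trans
      ((isBellmanSolution_optCost (S := S.perturb (δ n)) x).le.trans
        ((bellman_le (S.perturb (δ n)) hu).trans ?_))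
    rw [PMF.expect_add]
    refine add_le_add_left ?_ _
    rw [← PMF.expect_const (S.P x u) (δ n), ← PMF.expect_add]
    refine PMF.expect_mono _ fun w => ?_
    rw [← ENNReal.coe_add]
    refine ENNReal.coe_le_coe.2 (add_le_add_right ?_ _)
    split_ifs <;> simp
  have htend : Tendsto (fun n => (S.P x u).expect fun w =>
      (S.perturb (δ n)).optCost (S.f x u w)) atTop (𝓝 E) := by
    rw [hEeq]
    exact tendsto_atTop_iInf fun m n h =>
      PMF.expect_mono _ fun w => optCost_perturb_mono (hanti h) _
  have hsum := ((tendsto_const_nhds (x := (S.P x u).expect fun w => (S.g x u w : ℝ≥0∞))).add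
    (ENNReal.tendsto_coe.2 hlim)).add htend
  rw [ENNReal.coe_zero, add_zero] at hsum
  exact ge_of_tendsto' hsum hstep

theorem properOptCost_mem_boundedClass (hg : ∃ C : ℝ≥0, ∀ x u w, S.g x u w ≤ C)
    (hπ : ∃ π : S.Policy, S.UniformlyProper π) : S.properOptCost ∈ S.boundedClass := by
  obtain ⟨M, hM, hMle⟩ := exists_bound_optCost_perturb hg hπ 1
  have : Nonempty S.Policy := ⟨hπ.choose⟩
  exact ⟨properOptCost_destination, (iSup₂_le fun x hx =>
    (properOptCost_le_optCost_perturb one_pos x).trans (hMle x hx)).trans_lt hM⟩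

/-! ### Vanishing terminal costs and comparison -/

theorem tendsto_expect_of_mem_boundedClass {J : X → ℝ≥0∞} (hJ : J ∈ S.boundedClass)
    (hsupp : ∀ k, ∀ y ∈ (S.stateLaw π x k).support, y ∈ effDom S.properOptCost)
    (hr : Tendsto (S.notReached π x) atTop (𝓝 0)) :
    Tendsto (fun k => (S.stateLaw π x k).expect J) atTop (𝓝 0) := by
  classical
  set M := ⨆ y ∈ effDom S.properOptCost, J y with hM
  have h1 : Tendsto (fun k => M * S.notReached π x k) atTop (𝓝 (M * 0)) :=
    ENNReal.Tendsto.const_mul hr (Or.inr hJ.2.ne)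
  rw [mul_zero] at h1
  refine tendsto_of_tendsto_of_tendsto_of_le_of_le tendsto_const_nhds h1 (fun _ => zero_le)
    fun k => ?_
  simp only [notReached_eq_expect]
  rw [← PMF.expect_const_mul]
  refine PMF.expect_mono_support _ fun y hy => ?_
  by_cases h : y = S.t
  · simp [h, hJ.1]
  · simp only [h, if_false, mul_one]
    exact le_iSup₂ (f := fun y _ => J y) y (hsupp k y hy)

/-- Only `r_k → 0` is required, not summability, so that (c) can use it for policies not known to be
proper. -/
theorem tendsto_sum_stageCost_add_expect {J : X → ℝ≥0∞} (hJ : J ∈ S.boundedClass)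
    (hsupp : ∀ k, ∀ y ∈ (S.stateLaw π x k).support, y ∈ effDom S.properOptCost)
    (hr : Tendsto (S.notReached π x) atTop (𝓝 0)) :
    Tendsto (fun k => ∑ j ∈ Finset.range k, S.stageCost π x j + (S.stateLaw π x k).expect J)
      atTop (𝓝 (S.cost π x)) := by
  simpa [cost] using (ENNReal.tendsto_nat_tsum (S.stageCost π x)).add
    (tendsto_expect_of_mem_boundedClass hJ hsupp hr)

theorem ProperAt.tendsto_sum_stageCost_add_expect (h : S.ProperAt π x) {J : X → ℝ≥0∞}
    (hJ : J ∈ S.boundedClass) :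
    Tendsto (fun k => ∑ j ∈ Finset.range k, S.stageCost π x j + (S.stateLaw π x k).expect J)
      atTop (𝓝 (S.cost π x)) :=
  SSP.tendsto_sum_stageCost_add_expect hJ (fun _ _ hy => (h.shift hy).mem_effDom)
    (ENNReal.tendsto_atTop_zero_of_tsum_ne_top h.2.ne)

theorem le_properOptCost_of_le_bellman {J : X → ℝ≥0∞} (hJ : J ∈ S.boundedClass)
    (hle : J ≤ S.bellman J) : J ≤ S.properOptCost := fun x =>
  le_iInf₂ fun π hπ => ge_of_tendsto' (hπ.tendsto_sum_stageCost_add_expect hJ) fun k =>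
    le_sum_stageCost_add_expect π x (J := fun _ => J) (fun _ => hle) 0 k

theorem tendsto_valueIteration (hle : S.properOptCost ≤ S.bellman S.properOptCost)
    {J : ℕ → X → ℝ≥0∞} (h0 : J 0 ∈ S.boundedClass) (hJ0 : S.properOptCost ≤ J 0)
    (hJ : ∀ k x, J (k + 1) x = S.bellman (J k) x) (x : X) :
    Tendsto (fun k => J k x) atTop (𝓝 (S.properOptCost x)) := by
  have hlow : ∀ k, S.properOptCost ≤ J k := by
    intro k
    induction k with
    | zero => exact hJ0
    | succ k ih => exact fun x => ((hle x).trans (S.bellman_mono ih x)).trans (hJ k x).ge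
  refine tendsto_of_le_liminf_of_limsup_le ?_ ?_
  · exact le_liminf_of_le (by isBoundedDefault) (Eventually.of_forall fun k => hlow k x)
  · refine le_iInf₂ fun π hπ => ?_
    rw [← (hπ.tendsto_sum_stageCost_add_expect h0).limsup_eq]
    refine limsup_le_limsup (Eventually.of_forall fun k => ?_)
    simpa using le_sum_stageCost_add_expect π x (fun k y => (hJ k y).le) 0 k

/-- Over finitely many states with positive optimal costs, a policy of finite cost reaches the
destination with probability one. -/
theorem tendsto_notReached_of_cost_lt_top [Finite X] (hpos : ∀ x, x ≠ S.t → 0 < S.optCost x)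
    (h : S.cost π x < ⊤) : Tendsto (S.notReached π x) atTop (𝓝 0) := by
  classical
  obtain ⟨m, hm0, hm⟩ : ∃ m : ℝ≥0∞, m ≠ 0 ∧ ∀ y, y ≠ S.t → m ≤ S.optCost y := by
    by_cases hne : ∃ y, y ≠ S.t
    · have : Nonempty {y // y ≠ S.t} := ⟨⟨_, hne.choose_spec⟩⟩
      obtain ⟨y, hy⟩ := Finite.exists_min fun y : {y // y ≠ S.t} => S.optCost y
      exact ⟨S.optCost y, (hpos y y.2).ne', fun z hz => hy ⟨z, hz⟩⟩
    · exact ⟨1, one_ne_zero, fun y hy => absurd ⟨y, hy⟩ hne⟩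
  -- `optCost` may be infinite at every state but the destination; the bound is then truncated at
  -- `1`.
  wlog hmt : m ≠ ⊤ generalizing m
  · exact this (min m 1) (by simp [hm0]) (fun y hy => (min_le_left _ _).trans (hm y hy)) (by simp)
  have htail := ENNReal.tendsto_sum_nat_add (S.stageCost π x) h.ne
  have h1 := ENNReal.Tendsto.const_mul (a := m⁻¹) htail (Or.inr (ENNReal.inv_ne_top.2 hm0))
  rw [mul_zero] at h1
  refine tendsto_of_tendsto_of_tendsto_of_le_of_le tendsto_const_nhds h1 (fun _ => zero_le)
    fun k => ?_
  -- The tail from stage `k` is an expected cost-to-go, which is at least `m` off the destination.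
  simp only [tsum_stageCost_add]
  rw [notReached_eq_expect, ← PMF.expect_const_mul]
  refine PMF.expect_mono _ fun y => ?_
  split_ifs with hy
  · exact zero_le
  · calc (1 : ℝ≥0∞) = m⁻¹ * m := (ENNReal.inv_mul_cancel hm0 hmt).symm
      _ ≤ m⁻¹ * S.cost (S.shift k π) y := by
        gcongr
        exact (hm y hy).trans (iInf_le _ _)

theorem properOptCost_le_optCost [Finite X] (hB : S.properOptCost ∈ S.boundedClass)
    (hle : S.properOptCost ≤ S.bellman S.properOptCost)
    (hpos : ∀ x, x ≠ S.t → 0 < S.optCost x)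
    (hdom : effDom S.optCost ⊆ effDom S.properOptCost) : S.properOptCost ≤ S.optCost := by
  refine fun x => le_iInf fun π => ?_
  by_cases h : S.cost π x < ⊤
  · have hsupp : ∀ k, ∀ y ∈ (S.stateLaw π x k).support, y ∈ effDom S.properOptCost := by
      intro k y hy
      have h' := h
      rw [cost_eq_sum_add _ _ k, ENNReal.add_lt_top] at h'
      exact hdom ((iInf_le (fun π => S.cost π y) (S.shift k π)).trans_lt
        (PMF.lt_top_of_expect_lt_top h'.2 hy))
    exact ge_of_tendsto' (tendsto_sum_stageCost_add_expect hB hsupp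
      (tendsto_notReached_of_cost_lt_top hpos h)) fun k =>
        le_sum_stageCost_add_expect π x (J := fun _ => S.properOptCost) (fun _ => hle) 0 k
  · rw [not_lt, top_le_iff] at h
    exact h ▸ le_top

end SSP

end

theorem proposition7 {X U W : Type*} [Countable W] (S : SSP X U W)
    (hg : ∃ C : ℝ≥0, ∀ x u w, S.g x u w ≤ C)
    (hπ : ∃ π : S.Policy, S.UniformlyProper π) :
    -- (a)
    ((S.properOptCost ∈ S.boundedClass ∧ S.IsBellmanSolution S.properOptCost ∧
        ∀ J ∈ S.boundedClass, S.IsBellmanSolution J → J ≤ S.properOptCost) ∧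
      (S.properOptCost = S.optCost →
        S.optCost ∈ S.boundedClass ∧ S.IsBellmanSolution S.optCost ∧
        ∀ J ∈ S.boundedClass, S.IsBellmanSolution J → J = S.optCost)) ∧
    -- (b)
    (∀ J : ℕ → X → ℝ≥0∞, J 0 ∈ S.boundedClass → S.properOptCost ≤ J 0 →
      (∀ k x, J (k + 1) x = S.bellman (J k) x) →
      ∀ x, Filter.Tendsto (fun k => J k x) Filter.atTop (𝓝 (S.properOptCost x))) ∧
    -- (c)
    (Finite X → (∀ x, x ≠ S.t → 0 < S.optCost x) →
      SSP.effDom S.optCost = SSP.effDom S.properOptCost →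
      S.properOptCost = S.optCost) := by
  have : Nonempty S.Policy := ⟨hπ.choose⟩
  have hB := SSP.properOptCost_mem_boundedClass hg hπ
  have hle := SSP.properOptCost_le_bellman hg hπ
  have hsol : S.IsBellmanSolution S.properOptCost := fun x =>
    le_antisymm (hle x) (SSP.bellman_properOptCost_le ⟨hπ.choose⟩ x)
  have hmax : ∀ J ∈ S.boundedClass, S.IsBellmanSolution J → J ≤ S.properOptCost :=
    fun J hJ h => SSP.le_properOptCost_of_le_bellman hJ fun x => (h x).le
  refine ⟨⟨⟨hB, hsol, hmax⟩, fun heq => ⟨heq ▸ hB, heq ▸ hsol, fun J hJ h => ?_⟩⟩,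
    fun J h0 hJ0 hJ => SSP.tendsto_valueIteration hle h0 hJ0 hJ, fun hX hpos hdom => ?_⟩
  · exact le_antisymm (heq ▸ hmax J hJ h) (SSP.optCost_le_of_bellman_le fun x => (h x).ge)
  · exact le_antisymm (SSP.properOptCost_le_optCost hB hle hpos hdom.subset)
      SSP.optCost_le_properOptCost
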